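/- Let $n \ge 1$ and $m \ge 1$ be integers, and let $S^{n-1} = \{x \in \mathbb{R}^n : \|x\|_2 = 1\}$. Let $A \subseteq S^{n-1}$ be a measurable set of positive $(n-1)$-dimensional surface measure (counting measure if $n = 1$) which is symmetric, i.e. $-x \in A$ for every $x \in A$. Let $a_1, \dots, a_m$ be independent random points, each uniformly distributed on $A$ (with respect to surface measure), and for $a \in S^{n-1}$ let $C(a) = \{\delta \in S^{n-1} : \langle a, \delta\rangle > 0\}$ be the open hemispherical cap centred at $a$. Then $$\mathbb{P}\Big(S^{n-1} \subseteq \bigcup_{i=1}^m C(a_i)\Big) = 1 - \frac{1}{2^{m-1}} \sum_{k=0}^{n-1} \binom{m-1}{k},$$ and this probability equals the probability of getting at least $n$ heads in $m-1$ independent flips of a fair coin. -/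

import Mathlib

open MeasureTheory ProbabilityTheory

namespace SphereCover

/-- The unit sphere `S^{n-1} = {x ∈ ℝⁿ : ‖x‖₂ = 1}`. -/
abbrev unitSphere (n : ℕ) : Set (EuclideanSpace ℝ (Fin n)) :=
  Metric.sphere (0 : EuclideanSpace ℝ (Fin n)) 1

/-- The `(n-1)`-dimensional surface measure on the unit sphere of `ℝⁿ`
(for `n = 1` it is the counting measure on the two points of the sphere). -/
noncomputable abbrev surfaceMeasure (n : ℕ) : Measure (unitSphere n) :=
  (volume : Measure (EuclideanSpace ℝ (Fin n))).toSphere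

/-- The open semisphere (cap of central angle `π / 2`) centred at `a`. -/
def cap {n : ℕ} (a : EuclideanSpace ℝ (Fin n)) : Set (EuclideanSpace ℝ (Fin n)) :=
  {δ | δ ∈ unitSphere n ∧ 0 < inner ℝ a δ}

/-- A subset of the sphere is symmetric if it contains `-x` whenever it contains `x`. -/
def IsSymmetric {n : ℕ} (A : Set (unitSphere n)) : Prop :=
  ∀ x ∈ A, -x ∈ A

/-- The caps centred at the points `a i` cover the sphere. -/
def CapsCover {n m : ℕ} (a : Fin m → unitSphere n) : Prop :=
  unitSphere n ⊆ ⋃ i, cap (a i : EuclideanSpace ℝ (Fin n))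

/-- The law of `N` independent flips of a fair coin; `true` stands for heads. -/
noncomputable def fairCoins (N : ℕ) : Measure (Fin N → Bool) :=
  Measure.pi fun _ => (PMF.uniformOfFintype Bool).toMeasure

/-- The number of heads in a sequence of coin flips. -/
def heads {N : ℕ} (ω : Fin N → Bool) : ℕ :=
  (Finset.univ.filter fun i => ω i = true).card

end SphereCover

namespace SphereCover

open Module

/-! Outside a null set, the caps fail to cover exactly when all `a i` lie in one open half-space: an
uncovered `δ` satisfies `⟨a i, -δ⟩ ≥ 0` for all `i`, and general position lets these inequalities be
made strict (`GeneralPosition.exists_forall_inner_pos`). The half-space probability is Wendel's.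
Since `A` is symmetric, changing signs of the points preserves their joint law, so the probability
is an average over all `2 ^ m` sign patterns. In general position the number of favourable patterns
does not depend on the points: it counts the regions cut out by the hyperplanes orthogonal to them
(`ncard_signVectors`), by deletion and restriction. General position is almost sure because proper
subspaces are null. -/

/-- The vectors `f i` of a finite-dimensional space are in general position: any `k ≤ dim V` of
them are linearly independent. -/
def GeneralPosition {V : Type*} [AddCommGroup V] [Module ℝ V] {m : ℕ} (f : Fin m → V) : Prop :=
  ∀ k ≤ finrank ℝ V, ∀ e : Fin k → Fin m, Function.Injective e → LinearIndependent ℝ (f ∘ e)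

/-- The sign vectors realized by a family of linear functionals at a point off all their kernels;
they index the regions of the corresponding central hyperplane arrangement. -/
def signVectors {V : Type*} [AddCommGroup V] [Module ℝ V] {m : ℕ} (f : Fin m → Dual ℝ V) :
    Set (Fin m → ℤˣ) :=
  {ε | ∃ v, ∀ i, 0 < (ε i • f i) v}

/-! ### Counting regions of a central hyperplane arrangement. -/

section Arrangement

variable {V : Type*} [AddCommGroup V] [Module ℝ V] {m : ℕ}

lemma exists_pos_forall_pos_add_mul {ι : Type*} [Finite ι] (x y : ι → ℝ) (hx : ∀ i, 0 < x i) :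
    ∃ t > 0, ∀ i, 0 < x i + t * y i := by
  have h : ∀ᶠ t in nhdsWithin (0 : ℝ) (Set.Ioi 0), ∀ i, 0 < x i + t * y i := by
    rw [Filter.eventually_all]
    intro i
    have hc : ContinuousAt (fun t : ℝ => x i + t * y i) 0 := by fun_prop
    exact (hc.eventually_const_lt (by simpa using hx i)).filter_mono nhdsWithin_le_nhds
  obtain ⟨t, h, ht⟩ := (h.and self_mem_nhdsWithin).exists
  exact ⟨t, ht, h⟩

lemma GeneralPosition.ne_zero [Nontrivial V] [FiniteDimensional ℝ V] {f : Fin m → V}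
    (hf : GeneralPosition f) (i : Fin m) : f i ≠ 0 :=
  (hf 1 finrank_pos (fun _ => i) (Function.injective_of_subsingleton _)).ne_zero 0

lemma GeneralPosition.tail {f : Fin (m + 1) → V} (hf : GeneralPosition f) :
    GeneralPosition (Fin.tail f) := fun k hk e he =>
  hf k hk (Fin.succ ∘ e) ((Fin.succ_injective m).comp he)

/-- A functional vanishing on `ker (f 0)` is a multiple of `f 0`. Since `f 0` is independent of the
`k` chosen functionals, restriction to the kernel is injective on their span. -/
lemma GeneralPosition.domRestrict_ker [FiniteDimensional ℝ V] {f : Fin (m + 1) → Dual ℝ V}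
    (hf : GeneralPosition f) (h0 : f 0 ≠ 0) :
    GeneralPosition fun i => (Fin.tail f i).domRestrict (LinearMap.ker (f 0)) := by
  intro k hk e he
  rw [Subspace.dual_finrank_eq] at hk
  have hd := Dual.finrank_ker_add_one_of_ne_zero h0
  have hli := hf (k + 1) (by rw [Subspace.dual_finrank_eq]; omega)
    (Fin.cons 0 (Fin.succ ∘ e) : Fin (k + 1) → Fin (m + 1)) (by
      rw [Fin.cons_injective_iff]
      exact ⟨by simp [Fin.succ_ne_zero], (Fin.succ_injective m).comp he⟩)
  have hcons : f ∘ (Fin.cons 0 (Fin.succ ∘ e) : Fin (k + 1) → Fin (m + 1)) =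
      Fin.cons (f 0) (Fin.tail f ∘ e) := by
    funext i
    refine Fin.cases ?_ (fun j => ?_) i <;> simp [Fin.tail]
  rw [hcons, linearIndependent_finCons] at hli
  have := hli.1.map (f := (LinearMap.ker (f 0)).subtype.dualMap) (by
    rw [disjoint_comm, Submodule.disjoint_def]
    intro φ hφ hφ'
    have hker : LinearMap.ker (f 0) ≤ LinearMap.ker φ := fun v hv => by
      simpa using LinearMap.congr_fun (LinearMap.mem_ker.1 hφ) ⟨v, hv⟩
    obtain ⟨c, rfl⟩ : ∃ c : ℝ, c • f 0 = φ := by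
      have := mem_span_of_iInf_ker_le_ker (ι := Unit) (L := fun _ => f 0) (K := φ)
        (by simpa using hker)
      simpa [Submodule.mem_span_singleton] using this
    by_cases hc : c = 0
    · simp [hc]
    · exact absurd ((Submodule.smul_mem_iff _ hc).1 hφ') hli.2)
  exact this

/-- Deletion: a region is open, so it contains a point off the hyperplane `f 0 = 0`. -/
lemma signVectors_cons_union {f : Fin (m + 1) → Dual ℝ V} (h0 : f 0 ≠ 0) :
    {ε | Fin.cons 1 ε ∈ signVectors f} ∪ {ε | Fin.cons (-1) ε ∈ signVectors f} =
      signVectors (Fin.tail f) := by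
  ext ε
  simp only [Set.mem_union, Set.mem_ofPred_eq, signVectors, Fin.forall_fin_succ, Fin.cons_zero,
    Fin.cons_succ, Fin.tail]
  constructor
  · rintro (⟨v, -, hv⟩ | ⟨v, -, hv⟩) <;> exact ⟨v, hv⟩
  · rintro ⟨v, hv⟩
    obtain ⟨w, hw⟩ : ∃ w, (f 0) w ≠ 0 := by
      by_contra! h
      exact h0 (LinearMap.ext h)
    obtain ⟨u, hu, hu0⟩ : ∃ u, (∀ i : Fin m, 0 < (ε i • f i.succ) u) ∧ f 0 u ≠ 0 := by
      by_cases h : f 0 v = 0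
      · obtain ⟨t, ht, h'⟩ := exists_pos_forall_pos_add_mul _ (fun i => (ε i • f i.succ) w) hv
        exact ⟨v + t • w, fun i => by rw [map_add, map_smul]; exact h' i, by simp [h, ht.ne', hw]⟩
      · exact ⟨v, hv, h⟩
    rcases lt_or_gt_of_ne hu0 with h | h
    · exact Or.inr ⟨u, by simpa using h, hu⟩
    · exact Or.inl ⟨u, by simpa using h, hu⟩

/-- Restriction: by convexity, a region with points on both sides of the hyperplane meets it;
conversely a point on it can be pushed to either side. -/
lemma signVectors_cons_inter {f : Fin (m + 1) → Dual ℝ V} (h0 : f 0 ≠ 0) :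
    {ε | Fin.cons 1 ε ∈ signVectors f} ∩ {ε | Fin.cons (-1) ε ∈ signVectors f} =
      signVectors fun i => (Fin.tail f i).domRestrict (LinearMap.ker (f 0)) := by
  ext ε
  simp only [Set.mem_inter_iff, Set.mem_ofPred_eq, signVectors, Fin.forall_fin_succ, Fin.cons_zero,
    Fin.cons_succ, Fin.tail]
  have hsmul (i : Fin m) (v : LinearMap.ker (f 0)) :
      (ε i • (f i.succ).domRestrict (LinearMap.ker (f 0))) v = (ε i • f i.succ) v := by
    rcases Int.units_eq_one_or (ε i) with h | h <;> simp [h]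
  simp only [hsmul]
  constructor
  · rintro ⟨⟨v, hv0, hv⟩, ⟨w, hw0, hw⟩⟩
    simp only [one_smul, Units.neg_smul, LinearMap.neg_apply, Left.neg_pos_iff] at hv0 hw0
    -- Both weights are positive, and the values of `f 0` cancel.
    refine ⟨⟨(-f 0 w) • v + (f 0 v) • w, by simp [mul_comm]⟩, fun i => ?_⟩
    rw [map_add, map_smul, map_smul]
    exact add_pos (mul_pos (neg_pos.2 hw0) (hv i)) (mul_pos hv0 (hw i))
  · rintro ⟨⟨v, hv0⟩, hv⟩
    rw [LinearMap.mem_ker] at hv0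
    have key (η : ℤˣ) : ∃ u, 0 < (η • f 0) u ∧ ∀ i : Fin m, 0 < (ε i • f i.succ) u := by
      obtain ⟨w, hw⟩ : ∃ w, 0 < (η • f 0) w := by
        by_contra! h
        have h1 (w : V) : (η • f 0) w = 0 :=
          le_antisymm (h w) (by simpa using h (-w))
        exact h0 ((smul_eq_zero_iff_eq η).1 (LinearMap.ext h1))
      obtain ⟨t, ht, h'⟩ := exists_pos_forall_pos_add_mul _ (fun i => (ε i • f i.succ) w) hv
      refine ⟨v + t • w, ?_, fun i => by rw [map_add, map_smul]; exact h' i⟩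
      have : (η • f 0) v = 0 := by
        rcases Int.units_eq_one_or η with h | h <;> simp [h, hv0]
      rw [map_add, map_smul, this, zero_add]
      exact mul_pos ht hw
    exact ⟨key 1, key (-1)⟩

lemma ncard_signVectors_succ {f : Fin (m + 1) → Dual ℝ V} (h0 : f 0 ≠ 0) :
    (signVectors f).ncard = (signVectors (Fin.tail f)).ncard +
      (signVectors fun i => (Fin.tail f i).domRestrict (LinearMap.ker (f 0))).ncard := by
  rw [← signVectors_cons_union h0, ← signVectors_cons_inter h0,
    Set.ncard_union_add_ncard_inter _ _ (Set.toFinite _) (Set.toFinite _)]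
  have hinj (η : ℤˣ) : Function.Injective
      (Fin.cons (α := fun _ => ℤˣ) η : (Fin m → ℤˣ) → Fin (m + 1) → ℤˣ) :=
    Fin.cons_right_injective (α := fun _ => ℤˣ) η
  rw [← Set.ncard_image_of_injective _ (hinj 1), ← Set.ncard_image_of_injective _ (hinj (-1)),
    ← Set.ncard_union_eq]
  · congr 1
    ext ε
    simp only [Set.mem_union, Set.mem_image, Set.mem_ofPred_eq]
    constructor
    · intro h
      rcases Int.units_eq_one_or (ε 0) with h0 | h0
      · exact Or.inl ⟨Fin.tail ε, by rw [← h0, Fin.cons_self_tail]; exact ⟨h, rfl⟩⟩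
      · exact Or.inr ⟨Fin.tail ε, by rw [← h0, Fin.cons_self_tail]; exact ⟨h, rfl⟩⟩
    · rintro (⟨ε, h, rfl⟩ | ⟨ε, h, rfl⟩) <;> exact h
  · rw [Set.disjoint_left]
    rintro _ ⟨ε, -, rfl⟩ ⟨ε', -, h⟩
    exact absurd (congrFun h 0) (by simp)

lemma signVectors_of_finrank_eq_zero [FiniteDimensional ℝ V] (f : Fin (m + 1) → Dual ℝ V)
    (hV : finrank ℝ V = 0) : signVectors f = ∅ := by
  have := finrank_zero_iff.1 hV
  exact Set.eq_empty_of_forall_notMem fun ε ⟨v, hv⟩ => by simpa [Subsingleton.elim v 0] using hv 0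

lemma ncard_signVectors_of_isEmpty (f : Fin 0 → Dual ℝ V) : (signVectors f).ncard = 1 := by
  rw [Set.ncard_eq_one]
  exact ⟨1, by ext ε; simp [signVectors, Subsingleton.elim ε 1]⟩

/-- Schläfli's count of the regions of a central hyperplane arrangement in general position. -/
theorem ncard_signVectors [FiniteDimensional ℝ V] {f : Fin (m + 1) → Dual ℝ V}
    (hf : GeneralPosition f) :
    (signVectors f).ncard = 2 * ∑ k ∈ Finset.range (finrank ℝ V), m.choose k := by
  induction m generalizing V with
  | zero =>
    rcases hn : finrank ℝ V with _ | n
    · simp [signVectors_of_finrank_eq_zero f hn]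
    have := nontrivial_of_finrank_pos (R := ℝ) (M := V) (by omega)
    rw [ncard_signVectors_succ (hf.ne_zero 0), ncard_signVectors_of_isEmpty,
      ncard_signVectors_of_isEmpty, Finset.sum_range_succ']
    simp
  | succ m ih =>
    rcases hn : finrank ℝ V with _ | n
    · simp [signVectors_of_finrank_eq_zero f hn]
    have := nontrivial_of_finrank_pos (R := ℝ) (M := V) (by omega)
    have h0 : f 0 ≠ 0 := hf.ne_zero 0
    have hk : finrank ℝ (LinearMap.ker (f 0)) = n := by
      have := Dual.finrank_ker_add_one_of_ne_zero h0
      omega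
    rw [ncard_signVectors_succ h0, ih hf.tail, ih (hf.domRestrict_ker h0), hn, hk,
      Finset.sum_range_succ', Finset.sum_range_succ' (fun k => (m + 1).choose k)]
    -- With the `k = 0` terms split off, Pascal's rule matches the recursion.
    simp only [Nat.choose_succ_succ, Finset.sum_add_distrib, Nat.choose_zero_right]
    ring

end Arrangement

/-! ### From weak to strict inequalities. -/

section InnerProductSpace

variable {E : Type*} [NormedAddCommGroup E] [InnerProductSpace ℝ E] {m : ℕ}

lemma GeneralPosition.innerₛₗ_comp {b : Fin m → E} (hb : GeneralPosition b) :
    GeneralPosition fun i => innerₛₗ ℝ (b i) := by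
  intro k hk e he
  rw [Subspace.dual_finrank_eq] at hk
  refine (hb k hk e he).map' (innerₛₗ ℝ) (LinearMap.ker_eq_bot'.2 fun v hv => ?_)
  exact inner_self_eq_zero.1 (LinearMap.congr_fun hv v : inner ℝ v v = 0)

/-- In general position, a system of weak linear inequalities with a nonzero solution has a strict
solution. -/
theorem GeneralPosition.exists_forall_inner_pos [FiniteDimensional ℝ E] {b : Fin m → E}
    (hb : GeneralPosition b) {δ : E} (hδ : δ ≠ 0) (h : ∀ i, 0 ≤ inner ℝ (b i) δ) :
    ∃ v, ∀ i, 0 < inner ℝ (b i) v := by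
  classical
  let s : Finset (Fin m) := {i | inner ℝ (b i) δ = 0}
  have hli (t : Finset (Fin m)) (ht : t.card ≤ finrank ℝ E) : LinearIndependent ℝ fun i : t => b i :=
    (linearIndependent_equiv' t.equivFin.symm rfl).1
      (hb t.card ht (fun j => t.equivFin.symm j)
        (Subtype.val_injective.comp t.equivFin.symm.injective))
  -- Otherwise `finrank ℝ E` of the tight `b i` would span `E` while being orthogonal to `δ`.
  have hs : s.card ≤ finrank ℝ E := by
    by_contra! hs
    obtain ⟨t, hts, ht⟩ := Finset.exists_subset_card_eq hs.le
    have hspan := (hli t ht.le).span_eq_top_of_card_eq_finrank' (by simp [ht])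
    have : δ ∈ (⊤ : Submodule ℝ E)ᗮ := by
      rw [← hspan, Submodule.mem_orthogonal]
      intro u hu
      induction hu using Submodule.span_induction with
      | mem x hx =>
        obtain ⟨i, rfl⟩ := hx
        exact (Finset.mem_filter.1 (hts i.2)).2
      | zero => simp
      | add x y _ _ hx hy => rw [inner_add_left, hx, hy, add_zero]
      | smul c x _ hx => rw [inner_smul_left, hx, mul_zero]
    exact hδ (by simpa using this)
  -- The tight `b i` are independent, so some direction `w` increases all of them at once; a small
  -- step from `δ` along `w` keeps the other inequalities strict.
  obtain ⟨φ, hφ⟩ : ∃ φ : E →ₗ[ℝ] ℝ, ∀ i ∈ s, φ (b i) = 1 := by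
    obtain ⟨g, hg⟩ := (Finsupp.linearCombination ℝ fun i : s => b i).exists_leftInverse_of_injective
      (LinearMap.ker_eq_bot.2 (hli s hs))
    refine ⟨Finsupp.linearCombination ℝ (fun _ => (1 : ℝ)) ∘ₗ g, fun i hi => ?_⟩
    have : g (b i) = Finsupp.single ⟨i, hi⟩ 1 := by
      simpa using LinearMap.congr_fun hg (Finsupp.single ⟨i, hi⟩ 1)
    simp [this]
  obtain ⟨w, hw⟩ : ∃ w, ∀ i ∈ s, inner ℝ (b i) w = 1 :=
    ⟨(InnerProductSpace.toDual ℝ E).symm (LinearMap.toContinuousLinearMap φ), fun i hi => by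
      rw [real_inner_comm, InnerProductSpace.toDual_symm_apply]
      exact hφ i hi⟩
  obtain ⟨t, ht, htw⟩ := exists_pos_forall_pos_add_mul
    (fun i : {i // i ∉ s} => inner ℝ (b i) δ) (fun i => inner ℝ (b i) w) (fun i =>
      (h i).lt_of_ne' fun h0 => i.2 (Finset.mem_filter.2 ⟨Finset.mem_univ _, h0⟩))
  refine ⟨δ + t • w, fun i => ?_⟩
  rw [inner_add_right, inner_smul_right]
  by_cases hi : i ∈ s
  · rw [hw i hi, (Finset.mem_filter.1 hi).2]
    simpa using ht
  · exact htw ⟨i, hi⟩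

end InnerProductSpace

/-! ### Almost sure general position and Wendel's theorem. -/

section RandomVectors

lemma isOpen_setOf_exists_forall_inner_pos {E : Type*} [NormedAddCommGroup E]
    [InnerProductSpace ℝ E] (m : ℕ) :
    IsOpen {b : Fin m → E | ∃ v, ∀ i, 0 < inner ℝ (b i) v} := by
  simp only [Set.ofPred_exists, Set.ofPred_forall]
  exact isOpen_iUnion fun v => isOpen_iInter_of_finite fun i =>
    isOpen_lt continuous_const (by fun_prop)

variable {E : Type*} [NormedAddCommGroup E] [MeasurableSpace E] [BorelSpace E]

lemma measurableSet_setOf_linearIndependent [NormedSpace ℝ E] [FiniteDimensional ℝ E] (k : ℕ) :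
    MeasurableSet {v : Fin k → E | LinearIndependent ℝ v} :=
  isOpen_setOfPred_linearIndependent.measurableSet

/-- By Fubini with the other `k` vectors fixed first, the new one almost surely avoids their span,
which is proper. -/
lemma ae_linearIndependent_pi [NormedSpace ℝ E] [FiniteDimensional ℝ E] {ν : Measure E}
    [SigmaFinite ν] (hν : ∀ W : Submodule ℝ E, W ≠ ⊤ → ν W = 0) {k : ℕ} (hk : k ≤ finrank ℝ E) :
    ∀ᵐ v ∂Measure.pi fun _ : Fin k => ν, LinearIndependent ℝ v := by
  induction k with
  | zero => exact .of_forall fun v => linearIndependent_empty_type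
  | succ k ih =>
    have hmp := (measurePreserving_piFinSuccAbove (fun _ : Fin (k + 1) => ν) 0).symm
    have hS := measurableSet_setOf_linearIndependent (E := E) (k + 1)
    have hS' := hmp.measurable hS
    rw [← hmp.map_eq, ae_map_iff hmp.aemeasurable hS]
    refine (Measure.ae_prod_iff_ae_ae hS').2 ((Measure.ae_ae_comm
      (p := fun x v => LinearIndependent ℝ
        ((MeasurableEquiv.piFinSuccAbove (fun _ : Fin (k + 1) => E) 0).symm (x, v))) hS').2 ?_)
    filter_upwards [ih (by omega)] with v hv
    have hW : Submodule.span ℝ (Set.range v) ≠ ⊤ := fun h => by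
      have := finrank_range_le_card (R := ℝ) v
      rw [Set.finrank, h, finrank_top, Fintype.card_fin] at this
      omega
    filter_upwards [measure_eq_zero_iff_ae_notMem.1 (hν _ hW)] with x hx
    have : (MeasurableEquiv.piFinSuccAbove (fun _ : Fin (k + 1) => E) 0).symm (x, v) =
        (Fin.cons x v : Fin (k + 1) → E) := Fin.insertNth_zero' x v
    rw [this]
    exact linearIndependent_finCons.2 ⟨hv, hx⟩

lemma ae_generalPosition_pi [NormedSpace ℝ E] [FiniteDimensional ℝ E] {ν : Measure E}
    [IsProbabilityMeasure ν] (hν : ∀ W : Submodule ℝ E, W ≠ ⊤ → ν W = 0) (m : ℕ) :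
    ∀ᵐ b ∂Measure.pi fun _ : Fin m => ν, GeneralPosition b := by
  simp only [GeneralPosition, ae_all_iff]
  intro k hk e he
  -- Any subfamily indexed injectively again has a product law.
  have hind := (iIndepFun_pi (μ := fun _ : Fin m => ν) (X := fun _ => id)
    fun _ => aemeasurable_id).precomp he
  have hmap := (iIndepFun_iff_map_fun_eq_pi_map
    fun j => (measurable_pi_apply (e j)).aemeasurable).1 hind
  have heval (i : Fin m) : (Measure.pi fun _ : Fin m => ν).map (fun b => b i) = ν :=
    (measurePreserving_eval (fun _ : Fin m => ν) i).map_eq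
  simp only [heval] at hmap
  have h := ae_linearIndependent_pi hν hk
  rw [← hmap] at h
  have hm : Measurable fun (b : Fin m → E) (j : Fin k) => b (e j) := by fun_prop
  exact ae_of_ae_map (p := fun v => LinearIndependent ℝ v) hm.aemeasurable h

lemma measurePreserving_units_smul_pi {E : Type*} [NormedAddCommGroup E] [MeasurableSpace E]
    {ν : Measure E} [SigmaFinite ν] (hν : MeasurePreserving Neg.neg ν ν) {m : ℕ} (ε : Fin m → ℤˣ) :
    MeasurePreserving (fun b : Fin m → E => fun i => ε i • b i) (Measure.pi fun _ => ν)
      (Measure.pi fun _ => ν) := by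
  refine measurePreserving_pi _ _ fun i => ?_
  rcases Int.units_eq_one_or (ε i) with h | h
  · have : (HSMul.hSMul (1 : ℤˣ) : E → E) = id := funext fun x => one_smul _ x
    rw [h, this]
    exact MeasurePreserving.id ν
  · have : (HSMul.hSMul (-1 : ℤˣ) : E → E) = Neg.neg := funext fun x => by simp
    rwa [h, this]

variable [InnerProductSpace ℝ E]

open scoped ENNReal in
/-- Wendel's theorem: the probability that independent random vectors with a common symmetric law
lie in an open half-space. -/
theorem measure_pi_setOf_exists_forall_inner_pos [FiniteDimensional ℝ E] {ν : Measure E}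
    [IsProbabilityMeasure ν] (hν : ∀ W : Submodule ℝ E, W ≠ ⊤ → ν W = 0)
    (hneg : MeasurePreserving Neg.neg ν ν) (m : ℕ) :
    (Measure.pi fun _ : Fin (m + 1) => ν).real {b | ∃ v, ∀ i, 0 < inner ℝ (b i) v} =
      1 / 2 ^ m * ∑ k ∈ Finset.range (finrank ℝ E), (m.choose k : ℝ) := by
  classical
  set μ := Measure.pi fun _ : Fin (m + 1) => ν
  set G : Set (Fin (m + 1) → E) := {b | ∃ v, ∀ i, 0 < inner ℝ (b i) v}
  have hG : MeasurableSet G := (isOpen_setOf_exists_forall_inner_pos (m + 1)).measurableSet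
  let T (ε : Fin (m + 1) → ℤˣ) (b : Fin (m + 1) → E) : Fin (m + 1) → E := fun i => ε i • b i
  have hT (ε) : MeasurePreserving (T ε) μ μ := measurePreserving_units_smul_pi hneg ε
  have hmem (ε b) : T ε b ∈ G ↔ ε ∈ signVectors fun i => innerₛₗ ℝ (b i) := by
    refine exists_congr fun v => forall_congr' fun i => ?_
    rcases Int.units_eq_one_or (ε i) with h | h <;> simp [T, h]
  -- Pointwise, the favourable sign patterns are the regions of the arrangement; integrating this
  -- constant count gives `hsum`, as each `T ε` preserves `μ`.
  have hcount : ∀ᵐ b ∂μ, ∑ ε, (T ε ⁻¹' G).indicator (1 : (Fin (m + 1) → E) → ℝ≥0∞) b =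
      (2 * ∑ k ∈ Finset.range (finrank ℝ E), m.choose k : ℕ) := by
    filter_upwards [ae_generalPosition_pi hν (m + 1)] with b hb
    rw [← ncard_signVectors hb.innerₛₗ_comp, Set.ncard_eq_toFinset_card']
    simp only [Set.indicator_apply, Set.mem_preimage, hmem, Pi.one_apply, Finset.sum_boole]
    congr 2
    ext ε
    simp
  have hsum : 2 ^ (m + 1) * μ G = (2 * ∑ k ∈ Finset.range (finrank ℝ E), m.choose k : ℕ) := by
    calc 2 ^ (m + 1) * μ G = ∑ ε : Fin (m + 1) → ℤˣ, μ (T ε ⁻¹' G) := by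
          simp [(hT _).measure_preimage hG.nullMeasurableSet]
      _ = ∫⁻ b, ∑ ε, (T ε ⁻¹' G).indicator 1 b ∂μ := by
          rw [lintegral_finsetSum]
          · simp [lintegral_indicator_one ((hT _).measurable hG)]
          · exact fun ε _ => measurable_one.indicator ((hT ε).measurable hG)
      _ = _ := by rw [lintegral_congr_ae hcount]; simp [μ]
  have hreal := congrArg ENNReal.toReal hsum
  simp only [ENNReal.toReal_mul, ENNReal.toReal_pow, ENNReal.toReal_ofNat,
    ENNReal.toReal_natCast] at hreal
  rw [measureReal_def]
  push_cast at hreal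
  field_simp
  rw [pow_succ] at hreal
  linarith

end RandomVectors

/-! ### Symmetry and null sets of surface measure, read off from cones. -/

section Sphere

open Metric Measure
open scoped Pointwise

variable {E : Type*} [NormedAddCommGroup E] [NormedSpace ℝ E] [MeasurableSpace E] [BorelSpace E]
  [FiniteDimensional ℝ E] (μ : Measure E) [μ.IsAddHaarMeasure]

lemma measurePreserving_neg_toSphere :
    MeasurePreserving (Neg.neg : sphere (0 : E) 1 → sphere (0 : E) 1) μ.toSphere μ.toSphere := by
  have hm : Measurable (Neg.neg : sphere (0 : E) 1 → sphere (0 : E) 1) := continuous_neg.measurable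
  refine ⟨hm, Measure.ext fun s hs => ?_⟩
  rw [map_apply hm hs, toSphere_apply' _ (hm hs), toSphere_apply' _ hs,
    ← measure_preimage_neg μ (Set.Ioo (0 : ℝ) 1 • _)]
  congr 2
  ext x
  simp only [Set.mem_preimage, Set.mem_smul, Set.mem_image]
  constructor
  · rintro ⟨r, hr, _, ⟨y, hy, rfl⟩, h⟩
    exact ⟨r, hr, _, ⟨-y, hy, rfl⟩, by rw [coe_neg_sphere, smul_neg, h, neg_neg]⟩
  · rintro ⟨r, hr, _, ⟨y, hy, rfl⟩, rfl⟩
    exact ⟨r, hr, _, ⟨-y, by simpa using hy, rfl⟩, by rw [coe_neg_sphere, smul_neg]⟩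

lemma toSphere_preimage_submodule {W : Submodule ℝ E} (hW : W ≠ ⊤) :
    μ.toSphere ((↑) ⁻¹' (W : Set E)) = 0 := by
  rw [toSphere_apply' _
    (W.closed_of_finiteDimensional.measurableSet.preimage measurable_subtype_coe)]
  refine mul_eq_zero_of_right _ (measure_mono_null ?_ (addHaar_submodule μ W hW))
  rintro _ ⟨r, -, _, ⟨x, hx, rfl⟩, rfl⟩
  exact W.smul_mem r hx

end Sphere

/-! ### Fair coin flips. -/

section Coins

open Finset in
lemma card_filter_heads_eq (N k : ℕ) :
    #{c : Fin N → Bool | heads c = k} = N.choose k := by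
  rw [← Finset.card_fin N, ← card_powersetCard, Finset.card_fin]
  refine card_bij' (fun c _ => ({i | c i = true} : Finset (Fin N))) (fun s _ i => decide (i ∈ s))
    ?_ ?_ ?_ ?_
  · intro c hc
    exact mem_powersetCard.2 ⟨subset_univ _, (mem_filter.1 hc).2⟩
  · intro s hs
    exact mem_filter.2 ⟨mem_univ _, by simpa [heads] using (mem_powersetCard.1 hs).2⟩
  · intro c _
    simp
  · intro s _
    simp

instance isProbabilityMeasure_fairCoins (N : ℕ) : IsProbabilityMeasure (fairCoins N) := by
  unfold fairCoins; infer_instance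

lemma fairCoins_real (N : ℕ) (s : Finset (Fin N → Bool)) :
    (fairCoins N).real s = s.card / 2 ^ N := by
  have hsing (c : Fin N → Bool) : (fairCoins N).real {c} = 1 / 2 ^ N := by
    rw [fairCoins, measureReal_def, Measure.pi_singleton]
    simp
  rw [← sum_measureReal_singleton]
  simp [hsing, div_eq_mul_inv]

lemma fairCoins_real_le_heads (N n : ℕ) :
    (fairCoins N).real {c | n ≤ heads c} =
      1 - 1 / 2 ^ N * ∑ k ∈ Finset.range n, (N.choose k : ℝ) := by
  classical
  have hc : {c : Fin N → Bool | n ≤ heads c} =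
      ((Finset.univ.filter fun c : Fin N → Bool => heads c < n : Finset _) : Set _)ᶜ := by
    ext c; simp
  have hcard : (Finset.univ.filter fun c : Fin N → Bool => heads c < n).card =
      ∑ k ∈ Finset.range n, N.choose k := by
    rw [Finset.card_eq_sum_card_fiberwise (f := heads) (t := Finset.range n)
      (fun c hc => by simpa using hc)]
    refine Finset.sum_congr rfl fun k hk => ?_
    rw [← card_filter_heads_eq, Finset.filter_filter]
    congr 1
    ext c
    have := Finset.mem_range.1 hk
    simp only [Finset.mem_filter, Finset.mem_univ, true_and]
    omega
  rw [hc, probReal_compl_eq_one_sub (Finset.measurableSet _), fairCoins_real, hcard]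
  push_cast
  ring

end Coins

/-- Only the step from a non-covering to a half-space needs general position. -/
lemma capsCover_iff_of_generalPosition {n m : ℕ} (hm : 1 ≤ m) {a : Fin m → unitSphere n}
    (ha : GeneralPosition fun i => (a i : EuclideanSpace ℝ (Fin n))) :
    CapsCover a ↔
      ¬ ∃ v, ∀ i, 0 < inner ℝ (a i : EuclideanSpace ℝ (Fin n)) v := by
  have hcover : CapsCover a ↔ ∀ δ : EuclideanSpace ℝ (Fin n), ‖δ‖ = 1 →
      ∃ i, 0 < inner ℝ (a i : EuclideanSpace ℝ (Fin n)) δ := by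
    simp only [CapsCover, Set.subset_def, cap, Set.mem_iUnion, Set.mem_ofPred_eq, unitSphere,
      mem_sphere_zero_iff_norm]
    exact forall₂_congr fun δ hδ => by simp [hδ]
  rw [hcover]
  constructor
  · rintro h ⟨v, hv⟩
    have hv0 : v ≠ 0 := by
      rintro rfl
      simpa using hv ⟨0, hm⟩
    -- The point opposite to the direction of `v` lies in no cap.
    obtain ⟨i, hi⟩ := h (-(‖v‖⁻¹ • v)) (by
      rw [norm_neg, norm_smul, norm_inv, norm_norm, inv_mul_cancel₀ (norm_ne_zero_iff.2 hv0)])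
    rw [inner_neg_right, inner_smul_right] at hi
    have := mul_pos (inv_pos.2 (norm_pos_iff.2 hv0)) (hv i)
    linarith
  · intro h
    by_contra! ⟨δ, hδ, hle⟩
    refine h (ha.exists_forall_inner_pos (δ := -δ) ?_ fun i => ?_)
    · rw [neg_ne_zero, ← norm_ne_zero_iff, hδ]
      exact one_ne_zero
    · rw [inner_neg_right]
      exact neg_nonneg.2 (hle i)

lemma measurePreserving_neg_cond {n : ℕ} {A : Set (unitSphere n)} (hA : IsSymmetric A) :
    MeasurePreserving Neg.neg (cond (surfaceMeasure n) A) (cond (surfaceMeasure n) A) := by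
  have hpre : (Neg.neg : unitSphere n → unitSphere n) ⁻¹' A = A :=
    Set.Subset.antisymm (fun x hx => by simpa using hA _ hx) fun x hx => hA x hx
  have h := (measurePreserving_neg_toSphere (volume : Measure (EuclideanSpace ℝ (Fin n)))
    ).restrict_preimage_emb (Homeomorph.neg (unitSphere n)).measurableEmbedding A
  rw [hpre] at h
  exact h.smul_measure _

lemma cond_surfaceMeasure_map_submodule {n : ℕ} (A : Set (unitSphere n))
    {W : Submodule ℝ (EuclideanSpace ℝ (Fin n))} (hW : W ≠ ⊤) :
    (cond (surfaceMeasure n) A).map (↑) (W : Set (EuclideanSpace ℝ (Fin n))) = 0 := by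
  rw [Measure.map_apply measurable_subtype_coe W.closed_of_finiteDimensional.measurableSet]
  exact cond_absolutelyContinuous (toSphere_preimage_submodule volume hW)

end SphereCover

theorem lemma2 {n m : ℕ} (hm : 1 ≤ m)
    (A : Set (SphereCover.unitSphere n))
    (hA_meas : NullMeasurableSet A (SphereCover.surfaceMeasure n))
    (hA_pos : 0 < SphereCover.surfaceMeasure n A)
    (hA_symm : SphereCover.IsSymmetric A)
    {Ω : Type*} [MeasurableSpace Ω] (P : Measure Ω) [IsProbabilityMeasure P]
    (a : Fin m → Ω → SphereCover.unitSphere n)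
    (ha_indep : iIndepFun a P)
    (ha_unif : ∀ i, pdf.IsUniform (a i) A P (SphereCover.surfaceMeasure n)) :
    P.real {ω | SphereCover.CapsCover (fun i => a i ω)}
        = 1 - 1 / 2 ^ (m - 1) * ∑ k ∈ Finset.range n, ((m - 1).choose k : ℝ) ∧
      P.real {ω | SphereCover.CapsCover (fun i => a i ω)}
        = (SphereCover.fairCoins (m - 1)).real {c | n ≤ SphereCover.heads c} := by
  rw [SphereCover.fairCoins_real_le_heads, and_self]
  set σ := SphereCover.surfaceMeasure n
  have hprob : IsProbabilityMeasure (cond σ A) := cond_isProbabilityMeasure hA_pos.ne'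
  set ν : Measure (EuclideanSpace ℝ (Fin n)) := (cond σ A).map (↑) with hν
  have hνprob : IsProbabilityMeasure ν :=
    Measure.isProbabilityMeasure_map measurable_subtype_coe.aemeasurable
  have hνW (W : Submodule ℝ (EuclideanSpace ℝ (Fin n))) (hW : W ≠ ⊤) : ν W = 0 :=
    SphereCover.cond_surfaceMeasure_map_submodule A hW
  have hνneg : MeasurePreserving Neg.neg ν ν := by
    refine ⟨measurable_neg, ?_⟩
    conv_rhs => rw [hν, ← (SphereCover.measurePreserving_neg_cond hA_symm).map_eq]
    rw [hν, Measure.map_map measurable_neg measurable_subtype_coe, Measure.map_map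
      measurable_subtype_coe (SphereCover.measurePreserving_neg_cond hA_symm).measurable]
    rfl
  have ha_meas (i : Fin m) : AEMeasurable (a i) P :=
    (ha_unif i).aemeasurable hA_pos.ne' (measure_ne_top σ A)
  let X (i : Fin m) (ω : Ω) : EuclideanSpace ℝ (Fin n) := a i ω
  have hX_meas (i : Fin m) : AEMeasurable (X i) P :=
    measurable_subtype_coe.comp_aemeasurable (ha_meas i)
  have hX_law (i : Fin m) : P.map (X i) = ν := by
    rw [hν, ← ha_unif i, AEMeasurable.map_map_of_aemeasurable
      measurable_subtype_coe.aemeasurable (ha_meas i)]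
    rfl
  have hX_indep : iIndepFun X P := ha_indep.comp _ fun _ => measurable_subtype_coe
  have hX_joint : P.map (fun ω i => X i ω) = Measure.pi fun _ => ν := by
    rw [(iIndepFun_iff_map_fun_eq_pi_map hX_meas).1 hX_indep]
    simp only [hX_law]
  have hX_joint_meas : AEMeasurable (fun ω i => X i ω) P := aemeasurable_pi_lambda _ hX_meas
  have hgen : ∀ᵐ ω ∂P, SphereCover.GeneralPosition fun i => X i ω := by
    have := SphereCover.ae_generalPosition_pi hνW m
    rw [← hX_joint] at this
    exact ae_of_ae_map hX_joint_meas this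
  have hG := (SphereCover.isOpen_setOf_exists_forall_inner_pos
    (E := EuclideanSpace ℝ (Fin n)) m).measurableSet
  have hcover : {ω | SphereCover.CapsCover (fun i => a i ω)} =ᵐ[P] (fun ω i => X i ω) ⁻¹'
      {b | ∃ v, ∀ i, 0 < inner ℝ (b i) v}ᶜ := by
    filter_upwards [hgen] with ω hω
    exact propext (SphereCover.capsCover_iff_of_generalPosition hm hω)
  rw [measureReal_congr hcover, ← map_measureReal_apply_of_aemeasurable hX_joint_meas hG.compl,
    hX_joint, probReal_compl_eq_one_sub hG]
  obtain ⟨m, rfl⟩ := Nat.exists_eq_add_of_le' hm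
  rw [SphereCover.measure_pi_setOf_exists_forall_inner_pos hνW hνneg]
  simp
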